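/- **Setting.** Let $E$ be a Dedekind complete Riesz space with weak order unit $e\ge 0$ (the band generated by $e$ is $E$), and let $E^u$ be its universal completion, equipped with its $f$-algebra multiplication with unit $e$. A conditional expectation on $E$ is a strictly positive, order continuous linear projection $\mathbb F:E\to E$ with $\mathbb F e=e$ whose range $R(\mathbb F)$ is a Dedekind complete Riesz subspace; $R(\mathbb F)^{\pm}$ denotes the set of $f\in R(\mathbb F)$ with $\pm f\ge 0$. Let $L^\infty(\mathbb F)=\{f\in E^u: |f|\le u \text{ for some } u\in R(\mathbb F)\}$ (which is contained in $E$), and for $f\in L^\infty(\mathbb F)$ put $$M_{\mathbb F}(f)=\inf\{g\in R(\mathbb F): f\le g\},\qquad m_{\mathbb F}(f)=\sup\{g\in R(\mathbb F): g\le f\}.$$ Let $T\in\mathbb N$ and let $(\mathbb F_t)_{0\le t\le T}$ be a filtration, i.e. conditional expectations on $E$ with $\mathbb F_i\mathbb F_j=\mathbb F_j\mathbb F_i=\mathbb F_i$ for $i<j$. Let $(S_t)_{0\le t\le T}$ be a price process with $0\le S_t\in R(\mathbb F_t)$ for all $t\le T$ and $S_{t+1}\in L^\infty(\mathbb F_t)$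 for all $t<T$. For $0\le t<T$ let $$\mathcal V_{t,T}=\Big\{\sum_{i=t+1}^{T}\theta_{i-1}(S_i-S_{i-1}) : \theta_i\in R(\mathbb F_i)\Big\}\subset E^u,$$ $$P_{t,T}=\{p\in R(\mathbb F_t): p+v\ge 0\text{ for some }v\in\mathcal V_{t,T}\},\qquad A_{t,T}=\{v-\varepsilon: v\in\mathcal V_{t,T},\ \varepsilon\in R(\mathbb F_T)^+\}.$$ Absence of immediate profit (AIP) means that $P_{t,T}\cap R(\mathbb F_t)^-=\{0\}$ and $A_{t,T}\cap R(\mathbb F_t)^+=\{0\}$ for all $0\le t<T$. **Theorem.** AIP holds if and only if $$m_{\mathbb F_t}(S_{t+1})\le S_t\le M_{\mathbb F_t}(S_{t+1})\qquad\text{for all } 0\le t<T.$$ -/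

import Mathlib

namespace RieszMarket

section Riesz

variable {E : Type*} [AddCommGroup E] [Module ℝ E] [ConditionallyCompleteLattice E]

/-- A band: an order ideal that contains every supremum (existing in the space) of its subsets. -/
structure IsBand (B : Submodule ℝ E) : Prop where
  solid : ∀ f ∈ B, ∀ g : E, |g| ≤ |f| → g ∈ B
  sup_mem : ∀ D : Set E, D ⊆ (B : Set E) → ∀ a : E, IsLUB D a → a ∈ B

/-- A weak order unit: a nonnegative element such that the band it generates is the whole space. -/
structure IsWeakOrderUnit (e : E) : Prop where
  nonneg : 0 ≤ e
  band_eq_top : ∀ B : Submodule ℝ E, IsBand B → e ∈ B → B = ⊤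

/-- A conditional expectation operator: a strictly positive, order continuous linear projection
that fixes `e` and has a Dedekind complete range. (For a positive operator, order continuity means
that the image of any set directed downwards to `0` has infimum `0`.) -/
structure IsCondExp (e : E) (F : E →ₗ[ℝ] E) : Prop where
  nonneg : ∀ x, 0 ≤ x → 0 ≤ F x
  pos : ∀ x, 0 < x → 0 < F x
  order_continuous : ∀ D : Set E, D.Nonempty → DirectedOn (fun x y => y ≤ x) D →
    IsGLB D 0 → IsGLB (F '' D) 0
  idempotent : ∀ x, F (F x) = F x
  map_unit : F e = e
  range_sup_mem : ∀ x ∈ LinearMap.range F, ∀ y ∈ LinearMap.range F, x ⊔ y ∈ LinearMap.range F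
  range_complete : ∀ s : Set (LinearMap.range F), s.Nonempty → BddAbove s → ∃ a, IsLUB s a

/-- A filtration `F 0, …, F T` of conditional expectations; values beyond `T` are irrelevant. -/
structure IsFiltration (T : ℕ) (e : E) (F : ℕ → E →ₗ[ℝ] E) : Prop where
  condExp : ∀ t ≤ T, IsCondExp e (F t)
  tower_left : ∀ i j, i < j → j ≤ T → ∀ x, F i (F j x) = F i x
  tower_right : ∀ i j, i < j → j ≤ T → ∀ x, F j (F i x) = F i x

/-- An adapted process on `{0, …, T}`. -/
def IsAdapted (T : ℕ) (F : ℕ → E →ₗ[ℝ] E) (x : ℕ → E) : Prop :=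
  ∀ t ≤ T, x t ∈ LinearMap.range (F t)

/-- The space `L^∞(F)`: the elements that are dominated by an element of the range of `F`.
(A Dedekind complete Riesz space is an ideal of its universal completion, so the ideal generated
by the range of `F` in the universal completion already lies in `E`.) -/
def LInfty (F : E →ₗ[ℝ] E) : Set E :=
  {f | ∃ u ∈ LinearMap.range F, |f| ≤ u}

/-- The conditional supremum `M_F(f)`, for `f` in `L^∞(F)`. -/
noncomputable def condSup (F : E →ₗ[ℝ] E) (f : E) : E :=
  sInf {g | g ∈ LinearMap.range F ∧ f ≤ g}

/-- The conditional infimum `m_F(f)`, for `f` in `L^∞(F)`. -/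
noncomputable def condInf (F : E →ₗ[ℝ] E) (f : E) : E :=
  sSup {g | g ∈ LinearMap.range F ∧ g ≤ f}

end Riesz

section Market

variable {E : Type*} [AddCommGroup E] [Module ℝ E] [ConditionallyCompleteLattice E]
variable {U : Type*} [CommRing U] [Algebra ℝ U] [ConditionallyCompleteLattice U]

/-- `ι : E → U` exhibits `U` as the universal completion of `E`, with its `f`-algebra
multiplication for which `e` is the unit: `U` (Dedekind complete by its instance) is laterally
complete, `E` embeds as an order dense Riesz subspace, `U` is an `f`-algebra and `ι e = 1`. -/
structure IsUniversalCompletion (e : E) (ι : E →ₗ[ℝ] U) : Prop where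
  injective : Function.Injective ι
  map_sup : ∀ x y, ι (x ⊔ y) = ι x ⊔ ι y
  order_dense : ∀ u : U, 0 < u → ∃ x : E, 0 < x ∧ ι x ≤ u
  laterally_complete : ∀ D : Set U, D.Nonempty → D.Pairwise (fun x y => |x| ⊓ |y| = 0) →
    ∃ a, IsLUB D a
  f_algebra : ∀ a b c : U, 0 ≤ a → 0 ≤ b → 0 ≤ c → a ⊓ b = 0 → (a * c) ⊓ b = 0
  map_unit : ι e = 1

/-- The terminal value at `T` of the strategy `θ` started at time `t` with zero capital:
`∑_{i = t + 1}^{T} θ_{i-1} (S_i - S_{i-1})`, the products being taken in `U`. -/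
def gain (ι : E →ₗ[ℝ] U) (S θ : ℕ → E) (t T : ℕ) : U :=
  ∑ i ∈ Finset.Ico t T, ι (θ i) * ι (S (i + 1) - S i)

/-- The set `V_{t,T}` of terminal values of portfolios with zero initial capital at time `t`. -/
def terminalPortfolios (ι : E →ₗ[ℝ] U) (F : ℕ → E →ₗ[ℝ] E) (S : ℕ → E) (t T : ℕ) : Set U :=
  {v | ∃ θ : ℕ → E, IsAdapted T F θ ∧ v = gain ι S θ t T}

/-- The set `P_{t,T}(h)` of super-hedging prices at time `t` of the claim `h`. -/
def superhedgingPrices (ι : E →ₗ[ℝ] U) (F : ℕ → E →ₗ[ℝ] E) (S : ℕ → E) (t T : ℕ) (h : E) :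
    Set E :=
  {p | p ∈ LinearMap.range (F t) ∧ ∃ v ∈ terminalPortfolios ι F S t T, ι h ≤ ι p + v}

/-- The set `A_{t,T}` of claims that can be super-hedged from zero capital at time `t`. -/
def superhedgeableClaims (ι : E →ₗ[ℝ] U) (F : ℕ → E →ₗ[ℝ] E) (S : ℕ → E) (t T : ℕ) : Set U :=
  {a | ∃ v ∈ terminalPortfolios ι F S t T, ∃ ε ∈ LinearMap.range (F T), 0 ≤ ε ∧ a = v - ι ε}

/-- Absence of immediate profit: at every time `t < T`, the only nonpositive super-hedging price
of the zero claim is `0`, and the only nonnegative claim known at time `t` that can be super-hedged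
from zero capital is `0`. -/
def AIP (ι : E →ₗ[ℝ] U) (F : ℕ → E →ₗ[ℝ] E) (S : ℕ → E) (T : ℕ) : Prop :=
  ∀ t < T,
    superhedgingPrices ι F S t T 0 ∩ {p | p ∈ LinearMap.range (F t) ∧ p ≤ 0} = {0} ∧
    superhedgeableClaims ι F S t T ∩ ι '' {x | x ∈ LinearMap.range (F t) ∧ 0 ≤ x} = {0}

end Market

end RieszMarket

/-! A component, i.e. an idempotent of `U` coming from $R(\mathbb F_t)$, plays the role of an event
known at time $t$; multiplying by it restricts to that event.

Necessity: if $x = m_{\mathbb F_t}(S_{t+1}) - S_t$ were positive somewhere, holding one unit of the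
asset exactly there would earn at least $x^+$, so $-x^+$ would be a super-hedging price of zero
(`AIP.nonpos_of_isComponent`). Short selling handles $M_{\mathbb F_t}$.

Sufficiency: a price $p \not\ge 0$ is at most $-\delta$ on some nonzero component. No nonzero
component known at time $t$ carries $S_{t+1} - S_t \ge \eta > 0$ or $\le -\eta$
(`IsComponent.eq_zero_of_smul_le`), so one can pass to a nonzero subcomponent on which the next
trade gains at most half the remaining margin (`exists_isComponent_mul_le`). At time $T$ the value
$p + v$ is still negative somewhere. Both halves of AIP reduce to this. -/

namespace RieszMarket

/-! ### Dedekind complete ordered groups -/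

section OrderedGroup

variable {G : Type*} [AddCommGroup G] [ConditionallyCompleteLattice G] [IsOrderedAddMonoid G]

/-- A Dedekind complete lattice ordered group is Archimedean. -/
theorem nonpos_of_forall_nsmul_le {a b : G} (h : ∀ n : ℕ, n • a ≤ b) : a ≤ 0 := by
  have hb : BddAbove (Set.range fun n : ℕ => n • a) := ⟨b, by rintro _ ⟨n, rfl⟩; exact h n⟩
  have hs := isLUB_csSup (Set.range_nonempty fun n : ℕ => n • a) hb
  set s := sSup (Set.range fun n : ℕ => n • a)
  -- Shifting the index by one leaves the supremum unchanged.
  have : s ≤ s - a := hs.2 (by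
    rintro _ ⟨n, rfl⟩
    have := hs.1 ⟨n + 1, rfl⟩
    simp only [succ_nsmul] at this
    exact le_sub_iff_add_le.2 this)
  simpa using this

/-- Puts suprema into the form in which order continuity is stated. -/
theorem isLUB_image_sub_right {D : Set G} {a : G} :
    IsLUB D a ↔ IsGLB ((fun x => a - x) '' D) 0 := by
  constructor
  · intro h
    refine ⟨?_, fun b hb => ?_⟩
    · rintro _ ⟨x, hx, rfl⟩
      exact sub_nonneg.2 (h.1 hx)
    · have : a ≤ a - b := h.2 fun x hx => le_sub_comm.1 (hb ⟨x, hx, rfl⟩)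
      simpa using this
  · intro h
    refine ⟨fun x hx => sub_nonneg.1 (h.1 ⟨x, hx, rfl⟩), fun b hb => ?_⟩
    refine sub_nonpos.1 (h.2 ?_)
    rintro _ ⟨x, hx, rfl⟩
    exact sub_le_sub_left (hb hx) a

end OrderedGroup

/-! ### Disjointness and idempotents in an `f`-algebra -/

section FAlgebra

variable {U : Type*} [CommRing U] [ConditionallyCompleteLattice U] [IsOrderedRing U]

/-- Two uses of the `f`-algebra axiom make `a * b` disjoint from `b`, then from itself. -/
theorem mul_eq_zero_of_inf_eq_zero
    (hU : ∀ a b c : U, 0 ≤ a → 0 ≤ b → 0 ≤ c → a ⊓ b = 0 → (a * c) ⊓ b = 0)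
    {a b : U} (ha : 0 ≤ a) (hb : 0 ≤ b) (h : a ⊓ b = 0) : a * b = 0 := by
  have h1 := hU a b b ha hb hb h
  rw [inf_comm] at h1
  have h2 := hU b (a * b) a hb (mul_nonneg ha hb) ha h1
  rwa [mul_comm b a, inf_idem] at h2

/-- The component of `1` in the band generated by a positive element of an `f`-algebra. -/
theorem isIdempotentElem_of_isLUB
    (hU : ∀ a b c : U, 0 ≤ a → 0 ≤ b → 0 ≤ c → a ⊓ b = 0 → (a * c) ⊓ b = 0)
    {x p : U} (hx : 0 ≤ x) (hp : IsLUB (Set.range fun n : ℕ => n • x ⊓ 1) p) :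
    0 ≤ p ∧ p ≤ 1 ∧ p * p = p ∧ (1 - p) * x = 0 ∧ ∀ y, 0 ≤ y → x ⊓ y = 0 → p * y = 0 := by
  have h0 : 0 ≤ p := by
    refine le_trans ?_ (hp.1 ⟨0, rfl⟩)
    simp
  have hpu : p ≤ 1 := hp.2 (by rintro _ ⟨n, rfl⟩; exact inf_le_right)
  have hup : 0 ≤ 1 - p := sub_nonneg.2 hpu
  have hxp : x ⊓ (1 - p) = 0 := by
    refine le_antisymm ?_ (le_inf hx hup)
    -- Adding `x ⊓ (1 - p)` to the `n`-th term stays below the next term, hence below `p`.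
    have : p ≤ p - x ⊓ (1 - p) := hp.2 (by
      rintro _ ⟨n, rfl⟩
      refine le_sub_iff_add_le.2 (le_trans (le_inf ?_ ?_) (hp.1 ⟨n + 1, rfl⟩))
      · rw [succ_nsmul]
        exact add_le_add inf_le_left inf_le_left
      · calc n • x ⊓ 1 + x ⊓ (1 - p) ≤ p + (1 - p) := add_le_add (hp.1 ⟨n, rfl⟩) inf_le_right
          _ = 1 := by ring)
    simpa using this
  have hdisj : ∀ y, 0 ≤ y → x ⊓ y = 0 → p ⊓ y = 0 := by
    intro y hy hxy
    have hz : 0 ≤ p ⊓ y := le_inf h0 hy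
    refine le_antisymm ?_ hz
    have : p ≤ p - p ⊓ y := hp.2 (by
      rintro _ ⟨n, rfl⟩
      refine le_sub_iff_add_le.2 ?_
      have hn : n • x ⊓ y = 0 := by
        have := hU x y n hx hy (Nat.cast_nonneg n) hxy
        rwa [mul_comm, ← nsmul_eq_mul] at this
      have hi : (n • x ⊓ 1) ⊓ (p ⊓ y) = 0 := by
        refine le_antisymm (le_trans ?_ hn.le) (le_inf (le_inf (nsmul_nonneg hx n) zero_le_one) hz)
        exact inf_le_inf inf_le_left inf_le_right
      -- The sum of disjoint elements is their supremum, which lies below `p`.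
      have hs := inf_add_sup (n • x ⊓ 1) (p ⊓ y)
      rw [hi, zero_add] at hs
      rw [← hs]
      exact sup_le (hp.1 ⟨n, rfl⟩) inf_le_left)
    simpa using this
  have hpp := mul_eq_zero_of_inf_eq_zero hU h0 hup (hdisj _ hup hxp)
  refine ⟨h0, hpu, ?_, ?_, fun y hy hxy =>
    mul_eq_zero_of_inf_eq_zero hU h0 hy (hdisj y hy hxy)⟩
  · linear_combination -hpp
  · rw [mul_comm]
    exact mul_eq_zero_of_inf_eq_zero hU hx hup hxp

end FAlgebra

/-! ### Ranges of conditional expectations -/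

section CondExp

variable {E : Type*} [AddCommGroup E] [Module ℝ E] [ConditionallyCompleteLattice E]
  {e : E} {F : E →ₗ[ℝ] E}

theorem IsCondExp.apply_of_mem_range (hF : IsCondExp e F) {x : E} (hx : x ∈ LinearMap.range F) :
    F x = x := by
  obtain ⟨y, rfl⟩ := hx
  exact hF.idempotent y

theorem IsCondExp.unit_mem_range (hF : IsCondExp e F) : e ∈ LinearMap.range F :=
  ⟨e, hF.map_unit⟩

variable [IsOrderedAddMonoid E]

theorem IsCondExp.inf_mem_range (hF : IsCondExp e F) {x y : E} (hx : x ∈ LinearMap.range F)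
    (hy : y ∈ LinearMap.range F) : x ⊓ y ∈ LinearMap.range F := by
  have h := neg_mem (hF.range_sup_mem _ (neg_mem hx) _ (neg_mem hy))
  rwa [neg_sup, neg_neg, neg_neg] at h

/-- The range of a conditional expectation is closed under directed suprema. -/
theorem IsCondExp.isLUB_mem_range (hF : IsCondExp e F) {D : Set E} {a : E}
    (hD : D ⊆ LinearMap.range F) (hne : D.Nonempty) (hdir : DirectedOn (· ≤ ·) D)
    (ha : IsLUB D a) : a ∈ LinearMap.range F := by
  -- `F` fixes `D` pointwise, so `F a` is also a supremum of `D`, whence `F a = a`.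
  have h := hF.order_continuous _ (hne.image fun x => a - x) (by
    rintro _ ⟨x, hx, rfl⟩ _ ⟨y, hy, rfl⟩
    obtain ⟨z, hz, hxz, hyz⟩ := hdir x hx y hy
    exact ⟨_, ⟨z, hz, rfl⟩, sub_le_sub_left hxz a, sub_le_sub_left hyz a⟩)
    (isLUB_image_sub_right.1 ha)
  have h2 : F '' ((fun x => a - x) '' D) = (fun x => F a - x) '' D := by
    rw [Set.image_image]
    refine Set.image_congr fun x hx => ?_
    rw [map_sub, hF.apply_of_mem_range (hD hx)]
  rw [h2] at h
  exact ⟨a, (isLUB_image_sub_right.2 h).unique ha⟩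

theorem IsCondExp.isGLB_mem_range (hF : IsCondExp e F) {D : Set E} {a : E}
    (hD : D ⊆ LinearMap.range F) (hne : D.Nonempty) (hdir : DirectedOn (fun x y => y ≤ x) D)
    (ha : IsGLB D a) : a ∈ LinearMap.range F := by
  have h : -a ∈ LinearMap.range F := by
    refine hF.isLUB_mem_range (D := -D) (fun x hx => ?_) hne.neg ?_ ha.neg
    · simpa using neg_mem (hD hx)
    · intro x hx y hy
      obtain ⟨z, hz, hxz, hyz⟩ := hdir _ hx _ hy
      exact ⟨-z, by simpa using hz, le_neg_of_le_neg hxz, le_neg_of_le_neg hyz⟩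
  simpa using neg_mem h

theorem IsCondExp.isGLB_condSup (hF : IsCondExp e F) {f : E} (hf : f ∈ LInfty F) :
    condSup F f ∈ LinearMap.range F ∧
      IsGLB {g | g ∈ LinearMap.range F ∧ f ≤ g} (condSup F f) := by
  obtain ⟨u, hu, hfu⟩ := hf
  have hne : {g | g ∈ LinearMap.range F ∧ f ≤ g}.Nonempty := ⟨u, hu, (le_abs_self f).trans hfu⟩
  have h := isGLB_csInf hne ⟨f, fun g hg => hg.2⟩
  refine ⟨hF.isGLB_mem_range (fun g hg => hg.1) hne ?_ h, h⟩
  intro x hx y hy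
  exact ⟨x ⊓ y, ⟨hF.inf_mem_range hx.1 hy.1, le_inf hx.2 hy.2⟩, inf_le_left, inf_le_right⟩

theorem IsCondExp.isLUB_condInf (hF : IsCondExp e F) {f : E} (hf : f ∈ LInfty F) :
    condInf F f ∈ LinearMap.range F ∧
      IsLUB {g | g ∈ LinearMap.range F ∧ g ≤ f} (condInf F f) := by
  obtain ⟨u, hu, hfu⟩ := hf
  have hne : {g | g ∈ LinearMap.range F ∧ g ≤ f}.Nonempty := ⟨-u, neg_mem hu, neg_le.1 ((neg_le_abs f).trans hfu)⟩
  have h := isLUB_csSup hne ⟨f, fun g hg => hg.2⟩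
  refine ⟨hF.isLUB_mem_range (fun g hg => hg.1) hne ?_ h, h⟩
  intro x hx y hy
  exact ⟨x ⊔ y, ⟨hF.range_sup_mem _ hx.1 _ hy.1, sup_le hx.2 hy.2⟩, le_sup_left, le_sup_right⟩

end CondExp

/-! ### Components as events -/

section Component

variable {E : Type*} [AddCommGroup E] [Module ℝ E]
  {U : Type*} [CommRing U] [Algebra ℝ U] [PartialOrder U] {ι : E →ₗ[ℝ] U} {F : E →ₗ[ℝ] E}

/-- The components of the unit that belong to the range of `F`. -/
structure IsComponent (ι : E →ₗ[ℝ] U) (F : E →ₗ[ℝ] E) (c : U) : Prop where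
  nonneg : 0 ≤ c
  le_one : c ≤ 1
  mul_self : c * c = c
  mem_range : ∃ x ∈ LinearMap.range F, ι x = c

theorem IsComponent.mono {F' : E →ₗ[ℝ] E} (h : LinearMap.range F ≤ LinearMap.range F') {c : U}
    (hc : IsComponent ι F c) : IsComponent ι F' c := by
  obtain ⟨x, hx, hxc⟩ := hc.mem_range
  exact ⟨hc.nonneg, hc.le_one, hc.mul_self, x, h hx, hxc⟩

end Component

/-! ### Measurable components in the universal completion -/

section Completion

variable {E : Type*} [AddCommGroup E] [Module ℝ E] [ConditionallyCompleteLattice E]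
  {U : Type*} [CommRing U] [Algebra ℝ U] [ConditionallyCompleteLattice U]
  {e : E} {ι : E →ₗ[ℝ] U} {F : E →ₗ[ℝ] E}

theorem IsUniversalCompletion.le_iff (hι : IsUniversalCompletion e ι) {x y : E} :
    ι x ≤ ι y ↔ x ≤ y := by
  rw [← sup_eq_right, ← hι.map_sup, hι.injective.eq_iff, sup_eq_right]

theorem IsUniversalCompletion.map_nonneg (hι : IsUniversalCompletion e ι) {x : E} (hx : 0 ≤ x) :
    0 ≤ ι x := by
  rw [← map_zero ι]
  exact hι.le_iff.2 hx

variable [IsOrderedRing U]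

theorem IsComponent.one_sub (hι : IsUniversalCompletion e ι) (hF : IsCondExp e F) {c : U}
    (hc : IsComponent ι F c) : IsComponent ι F (1 - c) := by
  obtain ⟨x, hx, hxc⟩ := hc.mem_range
  refine ⟨sub_nonneg.2 hc.le_one, by simpa using hc.nonneg, ?_,
    e - x, sub_mem hF.unit_mem_range hx, by rw [map_sub, hι.map_unit, hxc]⟩
  linear_combination hc.mul_self

variable [IsOrderedAddMonoid E]

theorem IsUniversalCompletion.map_inf (hι : IsUniversalCompletion e ι) (x y : E) :
    ι (x ⊓ y) = ι x ⊓ ι y := by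
  have h := hι.map_sup (-x) (-y)
  rwa [← neg_inf, map_neg, map_neg, map_neg, ← neg_inf, neg_inj] at h

/-- The embedding into the universal completion preserves existing suprema. -/
theorem IsUniversalCompletion.isLUB_image (hι : IsUniversalCompletion e ι) {D : Set E} {a : E}
    (ha : IsLUB D a) : IsLUB (ι '' D) (ι a) := by
  refine ⟨?_, fun u hu => ?_⟩
  · rintro _ ⟨x, hx, rfl⟩
    exact hι.le_iff.2 (ha.1 hx)
  · by_contra hau
    have hlt : u ⊓ ι a < ι a := inf_lt_right.2 hau
    -- Order density fits a positive `x` of `E` into the gap, and `a - x` still bounds `D`.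
    obtain ⟨x, hx, hxu⟩ := hι.order_dense _ (sub_pos.2 hlt)
    have : a ≤ a - x := ha.2 fun d hd => by
      rw [← hι.le_iff, map_sub]
      exact le_trans (le_inf (hu ⟨d, hd, rfl⟩) (hι.le_iff.2 (ha.1 hd))) (le_sub_comm.1 hxu)
    exact absurd hx (not_lt_of_ge (by simpa using this))

/-- The product of two components is their infimum, and the range of `F` is closed under infima. -/
theorem IsComponent.mul (hι : IsUniversalCompletion e ι) (hF : IsCondExp e F) {c d : U}
    (hc : IsComponent ι F c) (hd : IsComponent ι F d) : IsComponent ι F (c * d) := by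
  obtain ⟨x, hx, hxc⟩ := hc.mem_range
  obtain ⟨y, hy, hyd⟩ := hd.mem_range
  have h1 : c * d ≤ c := mul_le_of_le_one_right hc.nonneg hd.le_one
  have h2 : c * d ≤ d := mul_le_of_le_one_left hd.nonneg hc.le_one
  refine ⟨mul_nonneg hc.nonneg hd.nonneg, h1.trans hc.le_one, ?_, x ⊓ y,
    hF.inf_mem_range hx hy, ?_⟩
  · linear_combination d * d * hc.mul_self + c * hd.mul_self
  · rw [hι.map_inf, hxc, hyd]
    refine le_antisymm ?_ (le_inf h1 h2)
    have h3 : (1 - c) * (c ⊓ d) ≤ 0 := by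
      calc (1 - c) * (c ⊓ d) ≤ (1 - c) * c :=
            mul_le_mul_of_nonneg_left inf_le_left (sub_nonneg.2 hc.le_one)
        _ = 0 := by linear_combination -hc.mul_self
    have h4 : c * (c ⊓ d) ≤ c * d := mul_le_mul_of_nonneg_left inf_le_right hc.nonneg
    calc c ⊓ d = (1 - c) * (c ⊓ d) + c * (c ⊓ d) := by ring
      _ ≤ 0 + c * d := add_le_add h3 h4
      _ = c * d := zero_add _

/-- The set where an `F`-measurable element is positive. -/
theorem IsCondExp.exists_isComponent (hι : IsUniversalCompletion e ι) (hF : IsCondExp e F) {x : E}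
    (hx : x ∈ LinearMap.range F) :
    ∃ d, IsComponent ι F d ∧ d * ι x = ι (x ⊔ 0) ∧ (1 - d) * ι x ≤ 0 := by
  have he : 0 ≤ e := by
    rw [← hι.le_iff, map_zero, hι.map_unit]
    exact zero_le_one
  have hy : x ⊔ 0 ∈ LinearMap.range F := hF.range_sup_mem _ hx _ (zero_mem _)
  have hy0 : 0 ≤ x ⊔ 0 := le_sup_right
  have hmono : Monotone fun n : ℕ => n • (x ⊔ 0) ⊓ e := fun m n hmn =>
    inf_le_inf_right _ (nsmul_le_nsmul_left hy0 hmn)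
  have hlub := isLUB_csSup (Set.range_nonempty fun n : ℕ => n • (x ⊔ 0) ⊓ e)
    ⟨e, by rintro _ ⟨n, rfl⟩; exact inf_le_right⟩
  set s := sSup (Set.range fun n : ℕ => n • (x ⊔ 0) ⊓ e)
  have hs : s ∈ LinearMap.range F := by
    refine hF.isLUB_mem_range ?_ (Set.range_nonempty _) ?_ hlub
    · rintro _ ⟨n, rfl⟩
      exact hF.inf_mem_range (nsmul_mem hy n) hF.unit_mem_range
    · exact directedOn_range.2 hmono.directed_le
  have hlubU : IsLUB (Set.range fun n : ℕ => n • ι (x ⊔ 0) ⊓ 1) (ι s) := by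
    have h := hι.isLUB_image hlub
    rw [← Set.range_comp] at h
    convert h using 2
    funext n
    simp [hι.map_inf, hι.map_unit]
  have hyU : 0 ≤ ι (x ⊔ 0) := by
    rw [← map_zero ι]
    exact hι.le_iff.2 hy0
  obtain ⟨h1, h2, h3, h4, h5⟩ := isIdempotentElem_of_isLUB hι.f_algebra hyU hlubU
  have hn0 : 0 ≤ ι (-x ⊔ 0) := by
    rw [← map_zero ι]
    exact hι.le_iff.2 le_sup_right
  have hsub : ι x = ι (x ⊔ 0) - ι (-x ⊔ 0) := by
    rw [← map_sub]
    congr 1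
    exact (posPart_sub_negPart x).symm
  have h6 := h5 (ι (-x ⊔ 0)) hn0 (by
    rw [← hι.map_inf, ← map_zero ι]
    congr 1
    exact posPart_inf_negPart_eq_zero x)
  refine ⟨ι s, ⟨h1, h2, h3, s, hs, rfl⟩, ?_, ?_⟩
  · rw [hsub]
    linear_combination -h4 - h6
  · have : (1 - ι s) * ι x = -ι (-x ⊔ 0) := by
      rw [hsub]
      linear_combination h4 + h6
    rw [this]
    exact neg_nonpos.2 hn0

/-- An element of the range of `F` is either at least `r` on a given component, or at most `r` on a
nonzero part of it. -/
theorem IsCondExp.exists_mul_le_smul (hι : IsUniversalCompletion e ι) (hF : IsCondExp e F)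
    {c : U} (hc0 : 0 ≤ c) {x : E} (hx : x ∈ LinearMap.range F) {r : ℝ}
    (hr : ¬ r • c ≤ c * ι x) :
    ∃ d, IsComponent ι F d ∧ c * d ≠ 0 ∧ d * ι x ≤ r • d := by
  obtain ⟨d, hd, hd1, hd2⟩ :=
    hF.exists_isComponent hι (sub_mem hx ((LinearMap.range F).smul_mem r hF.unit_mem_range))
  have hd3 : 0 ≤ d * ι (x - r • e) := hd1 ▸ hι.map_nonneg le_sup_right
  rw [map_sub, map_smul, hι.map_unit, Algebra.smul_def] at hd2 hd3
  rw [Algebra.smul_def] at hr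
  -- `1 - d` is the event `x ≤ r`; if it missed `c`, then `x ≥ r` would hold on `c`.
  refine ⟨1 - d, hd.one_sub hι hF, fun h => hr ?_, ?_⟩
  · have h1 := mul_nonneg hc0 hd3
    rw [← sub_nonneg]
    convert h1 using 1
    linear_combination (ι x - algebraMap ℝ U r) * h
  · rw [← sub_nonpos, Algebra.smul_def]
    convert hd2 using 1
    ring

theorem eq_zero_of_forall_smul_le {c b : U} (hc0 : 0 ≤ c) (h : ∀ n : ℕ, (n : ℝ) • c ≤ b) :
    c = 0 :=
  le_antisymm (nonpos_of_forall_nsmul_le (b := b) fun n => by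
    rw [← Nat.cast_smul_eq_nsmul ℝ]
    exact h n) hc0

variable [PosSMulMono ℝ U]

/-- A one-step position `θ` with uncertain payoff `θ * X` fails to be uniformly profitable on some
later component if `X` fails to be uniformly positive. -/
theorem exists_isComponent_mul_gain_le (hι : IsUniversalCompletion e ι) (hF : IsCondExp e F)
    {F' : E →ₗ[ℝ] E} (hF' : IsCondExp e F') (hFF' : LinearMap.range F ≤ LinearMap.range F')
    {c : U} (hc : IsComponent ι F c) (hc0 : c ≠ 0) {θ X : E} (hθ : θ ∈ LinearMap.range F)
    (hX : X ∈ LinearMap.range F') (hcθ : 0 ≤ c * ι θ)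
    (hpos : ∀ η : ℝ, 0 < η → ∀ d, IsComponent ι F d → η • d ≤ d * ι X → d = 0)
    {δ : ℝ} (hδ : 0 < δ) :
    ∃ c', IsComponent ι F' c' ∧ c' ≠ 0 ∧ c' * c = c' ∧ c' * (ι θ * ι X) ≤ δ • c' := by
  obtain ⟨n, hn⟩ : ∃ n : ℕ, ¬ (n : ℝ) • c ≤ c * ι θ := by
    by_contra! h
    exact hc0 (eq_zero_of_forall_smul_le hc.nonneg h)
  obtain ⟨d, hd, hcd, hdθ⟩ := hF.exists_mul_le_smul hι hc.nonneg hθ hn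
  -- On `c * d` the position is at most `n`, so a price move of at most `δ / (n + 1)` gains at most
  -- `δ`; the `+ 1` covers `n = 0`.
  have hη : 0 < δ / (n + 1) := by positivity
  have hcd' := hc.mul hι hF hd
  obtain ⟨b, hb, hcb, hbX⟩ := hF'.exists_mul_le_smul hι hcd'.nonneg hX
    fun h => hcd (hpos _ hη _ hcd' h)
  refine ⟨c * d * b, (hcd'.mono hFF').mul hι hF' hb, hcb,
    by linear_combination d * b * hc.mul_self, ?_⟩
  have hdb := mul_nonneg hd.nonneg hb.nonneg
  have h1 : 0 ≤ c * d * b * ι θ := by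
    convert mul_nonneg hdb hcθ using 1
    ring
  have h2 : c * d * b * ι θ ≤ (n : ℝ) • (c * d * b) := by
    convert mul_le_mul_of_nonneg_left hdθ (mul_nonneg hc.nonneg hb.nonneg) using 1
    · ring
    · simp only [Algebra.smul_def]
      ring
  have h3 : c * d * b * (ι θ * ι X) ≤ (δ / (n + 1)) • (c * d * b * ι θ) := by
    convert mul_le_mul_of_nonneg_left hbX h1 using 1
    · linear_combination -(c * d * ι θ * ι X) * hb.mul_self
    · simp only [Algebra.smul_def]
      linear_combination -(algebraMap ℝ U (δ / (n + 1)) * c * d * ι θ) * hb.mul_self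
  refine h3.trans ((smul_le_smul_of_nonneg_left h2 hη.le).trans ?_)
  rw [smul_smul, ← sub_nonneg, ← sub_smul]
  refine smul_nonneg ?_ (mul_nonneg hcd'.nonneg hb.nonneg)
  have : δ - δ / (n + 1) * n = δ / (n + 1) := by
    field_simp
    ring
  rw [this]
  exact hη.le

/-- If `m` is the largest element of the range of `F` below `Y` and `m ≤ Z`, then `Y` does not
uniformly exceed `Z` on any nonzero component. -/
theorem IsComponent.eq_zero_of_smul_le (hι : IsUniversalCompletion e ι) {m Y Z : E}
    (hm : m ∈ LinearMap.range F) (hmY : m ≤ Y) (hmax : ∀ g ∈ LinearMap.range F, g ≤ Y → g ≤ m)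
    (hmZ : m ≤ Z) {η : ℝ} (hη : 0 < η) {d : U} (hd : IsComponent ι F d)
    (h : η • d ≤ d * ι (Y - Z)) : d = 0 := by
  obtain ⟨x, hx, rfl⟩ := hd.mem_range
  -- On the component, `Y ≥ Z + η ≥ m + η`; off it, `Y ≥ m`. Maximality of `m` then forces `η • x ≤
  -- 0`.
  have hle : m + η • x ≤ Y := by
    rw [← hι.le_iff, map_add, map_smul, ← sub_nonneg]
    rw [Algebra.smul_def, ← sub_nonneg] at h
    have hmY' : 0 ≤ ι (Y - m) := hι.map_nonneg (sub_nonneg.2 hmY)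
    have hmZ' : 0 ≤ ι (Z - m) := hι.map_nonneg (sub_nonneg.2 hmZ)
    have h1 := add_nonneg (add_nonneg h (mul_nonneg hd.nonneg hmZ'))
      (mul_nonneg (sub_nonneg.2 hd.le_one) hmY')
    convert h1 using 1
    simp only [Algebra.smul_def, map_sub]
    ring
  have hx0 := hmax _ (add_mem hm ((LinearMap.range F).smul_mem η hx)) hle
  have hx1 : η • x ≤ 0 := by simpa using hx0
  have hx2 : η • ι x ≤ 0 := by
    rw [← map_smul, ← map_zero ι]
    exact hι.le_iff.2 hx1
  refine le_antisymm ?_ hd.nonneg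
  have := smul_le_smul_of_nonneg_left hx2 (inv_nonneg.2 hη.le)
  rwa [smul_smul, inv_mul_cancel₀ hη.ne', one_smul, smul_zero] at this

end Completion

/-! ### One-period strategies -/

section Strategy

variable {E : Type*} [AddCommGroup E] [Module ℝ E] {U : Type*} [CommRing U] [Algebra ℝ U]
  {T : ℕ} {F : ℕ → E →ₗ[ℝ] E} {ι : E →ₗ[ℝ] U}

theorem gain_single (S : ℕ → E) (x : E) {t : ℕ} (ht : t < T) :
    gain ι S (Pi.single t x) t T = ι x * ι (S (t + 1) - S t) := by
  rw [gain, Finset.sum_eq_single_of_mem t (Finset.left_mem_Ico.2 ht)]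
  · simp
  · intro i _ hi
    simp [hi]

theorem isAdapted_single {x : E} {t : ℕ} (hx : x ∈ LinearMap.range (F t)) :
    IsAdapted T F (Pi.single t x) := by
  intro i _
  obtain rfl | hi := eq_or_ne i t
  · simpa using hx
  · simp [hi]

end Strategy

/-! ### Absence of immediate profit and the price bounds -/

section Market

variable {E : Type*} [AddCommGroup E] [Module ℝ E] [ConditionallyCompleteLattice E]
  {e : E} {T : ℕ} {F : ℕ → E →ₗ[ℝ] E}

theorem IsFiltration.range_le (hF : IsFiltration T e F) {t : ℕ} (ht : t < T) :
    LinearMap.range (F t) ≤ LinearMap.range (F (t + 1)) := by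
  rintro _ ⟨x, rfl⟩
  exact ⟨F t x, hF.tower_right t (t + 1) t.lt_succ_self ht x⟩

variable [IsOrderedAddMonoid E]
  {U : Type*} [CommRing U] [Algebra ℝ U] [ConditionallyCompleteLattice U] [IsOrderedRing U]
  {ι : E →ₗ[ℝ] U}

/-- Under absence of immediate profit, a one-step position cannot dominate the positive part of an
element known at the initial time, on the set where this element is positive. -/
theorem AIP.nonpos_of_isComponent (hι : IsUniversalCompletion e ι) (hF : IsFiltration T e F)
    {S : ℕ → E} (h : AIP ι F S T) {t : ℕ} (ht : t < T) {x : E} (hx : x ∈ LinearMap.range (F t))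
    (hxS : x ≤ S (t + 1) - S t ∨ x ≤ S t - S (t + 1)) : x ≤ 0 := by
  obtain ⟨d, hd, hdx, -⟩ := (hF.condExp t ht.le).exists_isComponent hι hx
  obtain ⟨y, hy, rfl⟩ := hd.mem_range
  have hx0 : x ⊔ 0 ∈ LinearMap.range (F t) :=
    (hF.condExp t ht.le).range_sup_mem _ hx _ (zero_mem _)
  have key : ∃ z ∈ LinearMap.range (F t), ι (x ⊔ 0) ≤ ι z * ι (S (t + 1) - S t) := by
    rcases hxS with hxS | hxS
    · exact ⟨y, hy, hdx ▸ mul_le_mul_of_nonneg_left (hι.le_iff.2 hxS) hd.nonneg⟩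
    · refine ⟨-y, neg_mem hy, hdx ▸
        (mul_le_mul_of_nonneg_left (hι.le_iff.2 hxS) hd.nonneg).trans_eq ?_⟩
      simp only [map_sub, map_neg]
      ring
  obtain ⟨z, hz, hzx⟩ := key
  have hmem : -(x ⊔ 0) ∈ superhedgingPrices ι F S t T 0 ∩
      {p | p ∈ LinearMap.range (F t) ∧ p ≤ 0} := by
    refine ⟨⟨neg_mem hx0, _, ⟨_, isAdapted_single hz, rfl⟩, ?_⟩, neg_mem hx0,
      neg_nonpos.2 le_sup_right⟩
    rw [gain_single S z ht, map_zero, map_neg, neg_add_eq_sub]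
    exact sub_nonneg.2 hzx
  rw [(h t ht).1] at hmem
  rw [← sup_eq_right]
  simpa using hmem

theorem AIP.condInf_le_and_le_condSup (hι : IsUniversalCompletion e ι) (hF : IsFiltration T e F)
    {S : ℕ → E} (hS : IsAdapted T F S) (hS' : ∀ t < T, S (t + 1) ∈ LInfty (F t))
    (h : AIP ι F S T) {t : ℕ} (ht : t < T) :
    condInf (F t) (S (t + 1)) ≤ S t ∧ S t ≤ condSup (F t) (S (t + 1)) := by
  obtain ⟨hm, hmlub⟩ := (hF.condExp t ht.le).isLUB_condInf (hS' t ht)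
  obtain ⟨hM, hMglb⟩ := (hF.condExp t ht.le).isGLB_condSup (hS' t ht)
  have hm' : condInf (F t) (S (t + 1)) ≤ S (t + 1) := hmlub.2 fun g hg => hg.2
  have hM' : S (t + 1) ≤ condSup (F t) (S (t + 1)) := hMglb.2 fun g hg => hg.2
  exact ⟨sub_nonpos.1 (h.nonpos_of_isComponent hι hF ht (sub_mem hm (hS t ht.le))
      (.inl (sub_le_sub_right hm' _))),
    sub_nonpos.1 (h.nonpos_of_isComponent hι hF ht (sub_mem (hS t ht.le) hM)
      (.inr (sub_le_sub_left hM' _)))⟩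

variable [PosSMulMono ℝ U]

/-- Under the conditional bounds on prices, no one-step gain is uniformly positive on a nonzero
component. -/
theorem exists_isComponent_mul_le (hι : IsUniversalCompletion e ι) (hF : IsFiltration T e F)
    {S : ℕ → E} (hS : IsAdapted T F S) {t : ℕ} (ht : t < T) (hSt : S (t + 1) ∈ LInfty (F t))
    (hm : condInf (F t) (S (t + 1)) ≤ S t) (hM : S t ≤ condSup (F t) (S (t + 1)))
    {θ : E} (hθ : θ ∈ LinearMap.range (F t)) {c : U} (hc : IsComponent ι (F t) c) (hc0 : c ≠ 0)
    {δ : ℝ} (hδ : 0 < δ) :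
    ∃ c', IsComponent ι (F (t + 1)) c' ∧ c' ≠ 0 ∧ c' * c = c' ∧
      c' * (ι θ * ι (S (t + 1) - S t)) ≤ δ • c' := by
  have hFt := hF.condExp t ht.le
  have hX : S (t + 1) - S t ∈ LinearMap.range (F (t + 1)) :=
    sub_mem (hS (t + 1) ht) (hF.range_le ht (hS t ht.le))
  obtain ⟨hmr, hmlub⟩ := hFt.isLUB_condInf hSt
  obtain ⟨hMr, hMglb⟩ := hFt.isGLB_condSup hSt
  obtain ⟨d, hd, hdθ, hdθ'⟩ := hFt.exists_isComponent hι hθ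
  have hdθ0 : 0 ≤ d * ι θ := hdθ ▸ hι.map_nonneg le_sup_right
  -- If `c` misses the event `θ > 0`, then `θ ≤ 0` on `c`, and negating both `θ` and the increment
  -- turns the bound by `condSup` into one by an infimum.
  by_cases hcd : c * d = 0
  · have hc' : c * (1 - d) = c := by linear_combination -hcd
    obtain ⟨c', h1, h2, h3, h4⟩ := exists_isComponent_mul_gain_le hι hFt (hF.condExp (t + 1) ht)
      (hF.range_le ht) hc hc0 (neg_mem hθ) (neg_mem hX) (by
        rw [map_neg, ← hc', mul_assoc, mul_neg]
        exact mul_nonneg hc.nonneg (neg_nonneg.2 hdθ'))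
      (fun η hη b hb hbX => hb.eq_zero_of_smul_le hι (neg_mem hMr) (Y := -S (t + 1)) (Z := -S t)
        (neg_le_neg (hMglb.2 fun g hg => hg.2))
        (fun g hg hgS => le_neg_of_le_neg (hMglb.1 ⟨neg_mem hg, le_neg_of_le_neg hgS⟩))
        (neg_le_neg hM) hη (by convert hbX using 3; abel)) hδ
    exact ⟨c', h1, h2, h3, by simpa only [map_neg, neg_mul_neg] using h4⟩
  · obtain ⟨c', h1, h2, h3, h4⟩ := exists_isComponent_mul_gain_le hι hFt (hF.condExp (t + 1) ht)
      (hF.range_le ht) (hc.mul hι hFt hd) hcd hθ hX (by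
        rw [mul_assoc]
        exact mul_nonneg hc.nonneg hdθ0)
      (fun η hη b hb hbX => hb.eq_zero_of_smul_le hι hmr (hmlub.2 fun g hg => hg.2)
        (fun g hg hgS => hmlub.1 ⟨hg, hgS⟩) hm hη hbX) hδ
    exact ⟨c', h1, h2, by linear_combination (c - 1) * -h3 + c' * d * hc.mul_self, h4⟩

/-- A negative initial position stays uniformly negative on some nonzero component, whatever the
strategy. -/
theorem exists_isComponent_mul_add_gain_le (hι : IsUniversalCompletion e ι)
    (hF : IsFiltration T e F) {S : ℕ → E} (hS : IsAdapted T F S)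
    (hS' : ∀ t < T, S (t + 1) ∈ LInfty (F t))
    (h : ∀ t < T, condInf (F t) (S (t + 1)) ≤ S t ∧ S t ≤ condSup (F t) (S (t + 1)))
    {θ : ℕ → E} (hθ : IsAdapted T F θ) {t : ℕ} {p : E} (hp : p ∈ LinearMap.range (F t))
    (hp0 : ¬ 0 ≤ p) {n : ℕ} (htn : t ≤ n) (hn : n ≤ T) :
    ∃ c, IsComponent ι (F n) c ∧ c ≠ 0 ∧ ∃ δ : ℝ, 0 < δ ∧
      c * (ι p + gain ι S θ t n) ≤ -(δ • c) := by
  induction n, htn using Nat.le_induction with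
  | base =>
    have hone : IsComponent ι (F t) 1 :=
      ⟨zero_le_one, le_rfl, mul_one 1, e, (hF.condExp t hn).unit_mem_range, hι.map_unit⟩
    -- Archimedean property: `p ≥ -1 / (k + 1)` for every `k` would give `p ≥ 0`.
    obtain ⟨k, hk⟩ : ∃ k : ℕ, ¬ -((k : ℝ) + 1)⁻¹ • (1 : U) ≤ 1 * ι p := by
      by_contra! hk
      refine hp0 (neg_nonpos.1 (hι.le_iff.1 ?_))
      rw [map_zero]
      refine nonpos_of_forall_nsmul_le (b := 1) fun k => ?_
      have h1 : ι (-p) ≤ ((k : ℝ) + 1)⁻¹ • (1 : U) := by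
        rw [map_neg]
        refine neg_le.1 ?_
        simpa using hk k
      rw [← Nat.cast_smul_eq_nsmul ℝ]
      refine (smul_le_smul_of_nonneg_left h1 k.cast_nonneg).trans ?_
      rw [smul_smul, ← sub_nonneg]
      have h2 : (1 : U) - ((k : ℝ) * ((k : ℝ) + 1)⁻¹) • (1 : U) = ((k : ℝ) + 1)⁻¹ • (1 : U) := by
        nth_rewrite 1 [← one_smul ℝ (1 : U)]
        rw [← sub_smul]
        congr 1
        field_simp
        ring
      rw [h2]
      exact smul_nonneg (by positivity) zero_le_one
    obtain ⟨d, hd, hd0, hdp⟩ := (hF.condExp t hn).exists_mul_le_smul hι zero_le_one hp hk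
    refine ⟨d, hd, by simpa using hd0, ((k : ℝ) + 1)⁻¹, by positivity, ?_⟩
    simpa [gain] using hdp
  | succ n htn ih =>
    obtain ⟨c, hc, hc0, δ, hδ, hcδ⟩ := ih (by omega)
    obtain ⟨c', h1, h2, h3, h4⟩ := exists_isComponent_mul_le hι hF hS hn (hS' n hn) (h n hn).1
      (h n hn).2 (hθ n (by omega)) hc hc0 (half_pos hδ)
    refine ⟨c', h1, h2, δ / 2, half_pos hδ, ?_⟩
    have h5 : c' * (ι p + gain ι S θ t n) ≤ -(δ • c') := by
      convert mul_le_mul_of_nonneg_left hcδ h1.nonneg using 1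
      · linear_combination -(ι p + gain ι S θ t n) * h3
      · rw [mul_neg, mul_smul_comm, h3]
    have hg : gain ι S θ t (n + 1) = gain ι S θ t n + ι (θ n) * ι (S (n + 1) - S n) :=
      Finset.sum_Ico_succ_top htn _
    rw [hg, ← add_assoc, mul_add]
    refine (add_le_add h5 h4).trans_eq ?_
    module

/-- Under the conditional bounds on prices, super-hedging prices of zero are nonnegative. -/
theorem nonneg_of_nonneg_add_gain (hι : IsUniversalCompletion e ι)
    (hF : IsFiltration T e F) {S : ℕ → E} (hS : IsAdapted T F S)
    (hS' : ∀ t < T, S (t + 1) ∈ LInfty (F t))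
    (h : ∀ t < T, condInf (F t) (S (t + 1)) ≤ S t ∧ S t ≤ condSup (F t) (S (t + 1)))
    {θ : ℕ → E} (hθ : IsAdapted T F θ) {t : ℕ} (ht : t ≤ T) {p : E}
    (hp : p ∈ LinearMap.range (F t)) (hpv : 0 ≤ ι p + gain ι S θ t T) : 0 ≤ p := by
  by_contra hp0
  obtain ⟨c, hc, hc0, δ, hδ, hcδ⟩ :=
    exists_isComponent_mul_add_gain_le hι hF hS hS' h hθ hp hp0 ht le_rfl
  refine hc0 (le_antisymm ?_ hc.nonneg)
  have h1 : δ • c ≤ 0 := neg_nonneg.1 ((mul_nonneg hc.nonneg hpv).trans hcδ)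
  have h2 := smul_le_smul_of_nonneg_left h1 (inv_nonneg.2 hδ.le)
  rwa [smul_smul, inv_mul_cancel₀ hδ.ne', one_smul, smul_zero] at h2

theorem aip_of_condInf_le_of_le_condSup (hι : IsUniversalCompletion e ι)
    (hF : IsFiltration T e F) {S : ℕ → E} (hS : IsAdapted T F S)
    (hS' : ∀ t < T, S (t + 1) ∈ LInfty (F t))
    (h : ∀ t < T, condInf (F t) (S (t + 1)) ≤ S t ∧ S t ≤ condSup (F t) (S (t + 1))) :
    AIP ι F S T := by
  have hzero : ∀ t, (0 : U) ∈ terminalPortfolios ι F S t T := fun t =>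
    ⟨0, fun _ _ => zero_mem _, by simp [gain]⟩
  refine fun t ht => ⟨Set.eq_singleton_iff_unique_mem.2 ⟨?_, ?_⟩,
    Set.eq_singleton_iff_unique_mem.2 ⟨?_, ?_⟩⟩
  · exact ⟨⟨zero_mem _, 0, hzero t, by simp⟩, zero_mem _, le_rfl⟩
  · rintro p ⟨⟨hp, _, ⟨θ, hθ, rfl⟩, hpv⟩, -, hp0⟩
    rw [map_zero] at hpv
    exact le_antisymm hp0 (nonneg_of_nonneg_add_gain hι hF hS hS' h hθ ht.le hp hpv)
  · exact ⟨⟨0, hzero t, 0, zero_mem _, le_rfl, by simp⟩, 0, ⟨zero_mem _, le_rfl⟩, map_zero ι⟩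
  · rintro _ ⟨⟨_, ⟨θ, hθ, rfl⟩, ε, -, hε, hv⟩, x, ⟨hx, hx0⟩, rfl⟩
    -- Since `-x + v = ε ≥ 0`, `-x` is itself a super-hedging price of zero.
    have hx1 : 0 ≤ -x := by
      refine nonneg_of_nonneg_add_gain hι hF hS hS' h hθ ht.le (neg_mem hx) ?_
      rw [map_neg, hv]
      simpa using hι.map_nonneg hε
    rw [le_antisymm (neg_nonneg.1 hx1) hx0, map_zero]

end Market

end RieszMarket

theorem mainTheorem3
    {E : Type*} [AddCommGroup E] [Module ℝ E] [ConditionallyCompleteLattice E]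
    [IsOrderedAddMonoid E] [PosSMulMono ℝ E]
    {U : Type*} [CommRing U] [Algebra ℝ U] [ConditionallyCompleteLattice U]
    [IsOrderedRing U] [PosSMulMono ℝ U]
    (e : E) (he : RieszMarket.IsWeakOrderUnit e)
    (ι : E →ₗ[ℝ] U) (hι : RieszMarket.IsUniversalCompletion e ι)
    (T : ℕ) (F : ℕ → E →ₗ[ℝ] E) (hF : RieszMarket.IsFiltration T e F)
    (S : ℕ → E) (hS_adapted : RieszMarket.IsAdapted T F S) (hS_nonneg : ∀ t ≤ T, 0 ≤ S t)
    (hS_bdd : ∀ t < T, S (t + 1) ∈ RieszMarket.LInfty (F t)) :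
    RieszMarket.AIP ι F S T ↔
      ∀ t < T, RieszMarket.condInf (F t) (S (t + 1)) ≤ S t ∧
        S t ≤ RieszMarket.condSup (F t) (S (t + 1)) :=
  ⟨fun h _ ht => h.condInf_le_and_le_condSup hι hF hS_adapted hS_bdd ht,
    RieszMarket.aip_of_condInf_le_of_le_condSup hι hF hS_adapted hS_bdd⟩
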